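/- Let $\mathbb R_+=[0,\infty)$ and let $X_1,\dots,X_n$ be i.i.d. absolutely continuous nonnegative random variables. Let $\phi,\psi:\mathbb R_+\to\mathbb R_+$ be strictly monotone functions that are continuous on $[0,\infty)$ and twice continuously differentiable on $(0,\infty)$ (in particular, they may be any strictly monotone functions that are twice continuously differentiable on $[0,\infty)$), such that for all $u,v>0$ $$\phi''(u)\le 0\qquad\text{and}\qquad \phi''(u)\,\psi''(v)\,\phi(u)\,\psi(v)\ \ge\ [\phi'(u)\,\psi'(v)]^2 .$$ Assume that $X_1$ takes values in $\psi(\mathbb R_+)$ almost surely and that $\psi^{-1}(X_1)$ has a log-concave density, that is, a density $f:\mathbb R\to[0,\infty)$ with $f(\alpha x+(1-\alpha)y)\ge f(x)^{\alpha}f(y)^{1-\alpha}$ for all $x,y\in\mathbb R$, $\alpha\in[0,1]$. Let $a_1,\dots,a_n,b_1,\dots,b_n\in\phi(\mathbb R_+)$, and put $x_i=\phi^{-1}(b_i)$ and $y_i=\phi^{-1}(a_i)$. Write $x_{(1)}\le\dots\le x_{(n)}$ and $y_{(1)}\le\dots\le y_{(n)}$ for the increasing arrangements of $x$ and $y$.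 Each of the following conditions implies $$\sum_{i=1}^n a_iX_i\ \le_{\mathrm{st}}\ \sum_{i=1}^n b_iX_i ,\qquad\text{i.e.}\qquad P\Big(\sum_{i=1}^n a_iX_i\le t\Big)\ \ge\ P\Big(\sum_{i=1}^n b_iX_i\le t\Big)\quad\text{for all } t\in\mathbb R:$$ 1. $(\phi^{-1}(a_1),\dots,\phi^{-1}(a_n))\succeq_{\mathrm m}(\phi^{-1}(b_1),\dots,\phi^{-1}(b_n))$ (majorization): $\sum_{i=1}^n x_{(i)}=\sum_{i=1}^n y_{(i)}$ and $\sum_{i=1}^j x_{(i)}\ge\sum_{i=1}^j y_{(i)}$ for $j=1,\dots,n-1$; 2. $\phi$ is increasing and $(\phi^{-1}(a_1),\dots,\phi^{-1}(a_n))\succeq^{\mathrm w}(\phi^{-1}(b_1),\dots,\phi^{-1}(b_n))$ (weak supmajorization): $\sum_{i=1}^j x_{(i)}\ge\sum_{i=1}^j y_{(i)}$ for $j=1,\dots,n$; 3. $\phi$ is decreasing and $(\phi^{-1}(a_1),\dots,\phi^{-1}(a_n))\succeq_{\mathrm w}(\phi^{-1}(b_1),\dots,\phi^{-1}(b_n))$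 (weak submajorization): $\sum_{i=j}^n x_{(i)}\le\sum_{i=j}^n y_{(i)}$ for $j=1,\dots,n$. -/

import Mathlib

open MeasureTheory ProbabilityTheory Set

/-- The increasing arrangement `x₍₁₎ ≤ x₍₂₎ ≤ ⋯ ≤ x₍ₙ₎` of the components of `x`. -/
noncomputable def increasingArrangement {n : ℕ} (x : Fin n → ℝ) : Fin n → ℝ :=
  x ∘ Tuple.sort x

/-- `x` is majorized by `y` : the sums of all components agree, and for `j = 1, …, n - 1` the sum
of the `j` smallest components of `x` is at least that of `y`. -/
def MajorizedBy {n : ℕ} (x y : Fin n → ℝ) : Prop :=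
  (∑ i, increasingArrangement x i = ∑ i, increasingArrangement y i) ∧
    ∀ j : Fin n, (j : ℕ) + 1 < n →
      ∑ i ∈ Finset.Iic j, increasingArrangement y i ≤
        ∑ i ∈ Finset.Iic j, increasingArrangement x i

/-- `x` is weakly supmajorized by `y` : for `j = 1, …, n` the sum of the `j` smallest components
of `x` is at least that of `y`. -/
def WeaklySupmajorizedBy {n : ℕ} (x y : Fin n → ℝ) : Prop :=
  ∀ j : Fin n,
    ∑ i ∈ Finset.Iic j, increasingArrangement y i ≤
      ∑ i ∈ Finset.Iic j, increasingArrangement x i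

/-- `x` is weakly submajorized by `y` : for `j = 1, …, n` the sum of the components number
`j, …, n` in the increasing arrangement of `x` is at most that of `y`. -/
def WeaklySubmajorizedBy {n : ℕ} (x y : Fin n → ℝ) : Prop :=
  ∀ j : Fin n,
    ∑ i ∈ Finset.Ici j, increasingArrangement x i ≤
      ∑ i ∈ Finset.Ici j, increasingArrangement y i

/-- The usual stochastic order `X ≤_st Y` : the distribution functions satisfy `F_X ≥ F_Y`. -/
def StochasticLE {Ω : Type*} [MeasurableSpace Ω] (μ : Measure Ω) (X Y : Ω → ℝ) : Prop :=
  ∀ t : ℝ, μ {ω | Y ω ≤ t} ≤ μ {ω | X ω ≤ t}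

/-- A function `f : ℝ → ℝ` (to be used for nonnegative `f`) is log-concave on `ℝ`. -/
def IsLogConcave (f : ℝ → ℝ) : Prop :=
  ∀ x y α : ℝ, 0 ≤ α → α ≤ 1 →
    f x ^ α * f y ^ (1 - α) ≤ f (α * x + (1 - α) * y)

/-- The random variable `Y` has a log-concave density with respect to Lebesgue measure. -/
def HasLogConcaveDensity {Ω : Type*} [MeasurableSpace Ω] (μ : Measure Ω) (Y : Ω → ℝ) : Prop :=
  AEMeasurable Y μ ∧
    ∃ f : ℝ → ℝ, Measurable f ∧ (∀ x, 0 ≤ f x) ∧ IsLogConcave f ∧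
      μ.map Y = (volume : Measure ℝ).withDensity (fun x => ENNReal.ofReal (f x))

/-- The inverse of a function on `ℝ₊ = [0, ∞)` : if `g` is injective on `[0, ∞)` and `x` lies in
`g '' [0, ∞)`, it is the unique `u ≥ 0` with `g u = x`. Only used at such `x`. -/
noncomputable def inverseOnNonneg (g : ℝ → ℝ) : ℝ → ℝ :=
  Function.invFunOn g (Ici 0)

/-! In law `X i` is `ψ (V i)` with the `V i` independent copies of one variable with log-concave
density, so the tail at `t` of the sum with coefficients `φ (x i)` is the product measure of a
superlevel set S(x) in the nonnegative orthant.

The condition on second derivatives says exactly that the Hessian of φ(u)ψ(v) is negative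
semidefinite. Hence the product is jointly concave, and αS(x) + βS(z) ⊆ S(αx + βz) for α + β = 1.
The product measure satisfies Prékopa–Leindler, so x ↦ P(S(x)) is quasi-concave. It is also
permutation invariant, since the coordinates are i.i.d., and monotone, since φ increases. Therefore
{z ≥ 0 | P(S(z)) ≥ P(S(y))} is convex, symmetric and closed upwards. Weak supmajorization puts x
above a point of the convex hull of the permutations of y, hence in this set
(`WeaklySupmajorizedBy.measure_superlevelSet_le`).

Majorization is a special case. A nonnegative concave function on a half-line cannot strictly
decrease, so the case of decreasing φ is void. -/

/-! ### The Prékopa–Leindler inequality and its stability properties. -/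

section PrekopaLeindler

open scoped ENNReal Pointwise

/-- The one-dimensional Brunn–Minkowski inequality for nonempty compact sets. -/
theorem volume_add_le_volume_add_of_isCompact {K L : Set ℝ} (hK : IsCompact K) (hL : IsCompact L)
    (hK0 : K.Nonempty) (hL0 : L.Nonempty) : volume K + volume L ≤ volume (K + L) := by
  obtain ⟨k, hk, hkmax⟩ := hK.exists_isGreatest hK0
  obtain ⟨l, hl, hlmin⟩ := hL.exists_isLeast hL0
  -- With `k = max K` and `l = min L`, the two translates lie on either side of `k + l` and can meet
  -- only there.
  have hsub : (l +ᵥ K) ∪ (k +ᵥ L) ⊆ K + L := by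
    rintro _ (⟨x, hx, rfl⟩ | ⟨x, hx, rfl⟩)
    · exact ⟨x, hx, l, hl, add_comm _ _⟩
    · exact ⟨k, hk, x, hx, rfl⟩
  have hinter : volume ((l +ᵥ K) ∩ (k +ᵥ L)) = 0 := by
    refine measure_mono_null (t := {k + l}) ?_ (by simp)
    rintro _ ⟨⟨x, hx, rfl⟩, ⟨y, hy, hxy⟩⟩
    simp only [vadd_eq_add] at hxy ⊢
    have := hkmax hx
    have := hlmin hy
    simp only [mem_singleton_iff]
    linarith
  calc volume K + volume L = volume (l +ᵥ K) + volume (k +ᵥ L) := by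
        rw [measure_vadd, measure_vadd]
    _ = volume ((l +ᵥ K) ∪ (k +ᵥ L)) := by
        rw [← measure_union_add_inter _ ((hL.vadd k).measurableSet), hinter, add_zero]
    _ ≤ volume (K + L) := measure_mono hsub

/-- Inner regularity reduces this to compact sets. -/
theorem volume_convex_combination_le {A B C : Set ℝ} (hA : MeasurableSet A) (hB : MeasurableSet B)
    (hA0 : A.Nonempty) (hB0 : B.Nonempty) {α β : ℝ} (hα : 0 < α) (hβ : 0 < β)
    (hC : ∀ x ∈ A, ∀ y ∈ B, α * x + β * y ∈ C) :
    ENNReal.ofReal α * volume A + ENNReal.ofReal β * volume B ≤ volume C := by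
  obtain ⟨a₀, ha₀⟩ := hA0
  obtain ⟨b₀, hb₀⟩ := hB0
  have key : ∀ K ⊆ A, IsCompact K → ∀ L ⊆ B, IsCompact L →
      ENNReal.ofReal α * volume K + ENNReal.ofReal β * volume L ≤ volume C := by
    intro K hKA hK L hLB hL
    -- The approximating compact sets may be empty, where Brunn–Minkowski fails; one added point
    -- repairs this.
    have hK' : IsCompact (insert a₀ K) := hK.insert a₀
    have hL' : IsCompact (insert b₀ L) := hL.insert b₀
    have h := volume_add_le_volume_add_of_isCompact (hK'.smul α) (hL'.smul β)
      ((insert_nonempty _ _).smul_set) ((insert_nonempty _ _).smul_set)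
    simp only [Measure.addHaar_smul, Module.finrank_self, pow_one, abs_of_pos hα,
      abs_of_pos hβ] at h
    calc _ ≤ ENNReal.ofReal α * volume (insert a₀ K)
          + ENNReal.ofReal β * volume (insert b₀ L) := by
          gcongr <;> exact subset_insert _ _
      _ ≤ _ := h
      _ ≤ volume C := by
          refine measure_mono ?_
          rintro _ ⟨_, ⟨x, hx, rfl⟩, _, ⟨y, hy, rfl⟩, rfl⟩
          refine hC x ?_ y ?_
          · exact (insert_subset ha₀ hKA) hx
          · exact (insert_subset hb₀ hLB) hy
  rw [hA.measure_eq_iSup_isCompact, hB.measure_eq_iSup_isCompact]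
  simp only [ENNReal.mul_iSup, iSup_and']
  exact ENNReal.biSup_add_biSup_le' ⟨∅, empty_subset _, isCompact_empty⟩
    ⟨∅, empty_subset _, isCompact_empty⟩ fun K hK L hL => key K hK.1 hK.2 L hL.1 hL.2

theorem ennreal_geom_mean_le_arith_mean {α β : ℝ} (hα : 0 < α) (hβ : 0 < β) (h1 : α + β = 1)
    (p q : ℝ≥0∞) : p ^ α * q ^ β ≤ ENNReal.ofReal α * p + ENNReal.ofReal β * q := by
  rcases eq_or_ne p ∞ with rfl | hp
  · rw [ENNReal.mul_top (by simpa using hα)]; simp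
  rcases eq_or_ne q ∞ with rfl | hq
  · rw [ENNReal.mul_top (by simpa using hβ)]; simp
  lift p to NNReal using hp
  lift q to NNReal using hq
  lift α to NNReal using hα.le
  lift β to NNReal using hβ.le
  rw [← ENNReal.coe_rpow_of_nonneg _ hα.le, ← ENNReal.coe_rpow_of_nonneg _ hβ.le,
    ENNReal.ofReal_coe_nnreal, ENNReal.ofReal_coe_nnreal]
  exact_mod_cast NNReal.geom_mean_le_arith_mean2_weighted α β p q (by exact_mod_cast h1)

theorem lintegral_eq_lintegral_Ioi_volume_lt_toReal {f : ℝ → ℝ≥0∞} (hf : Measurable f)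
    (hf' : ∀ x, f x ≠ ∞) :
    ∫⁻ x, f x = ∫⁻ t in Ioi (0 : ℝ), volume {x | ENNReal.ofReal t < f x} := by
  have h := lintegral_eq_lintegral_meas_lt (f := fun x => (f x).toReal) volume
    (ae_of_all _ fun x => ENNReal.toReal_nonneg) hf.ennreal_toReal.aemeasurable
  simp only [ENNReal.ofReal_toReal (hf' _)] at h
  rw [h]
  refine setLIntegral_congr_fun measurableSet_Ioi fun t ht => ?_
  simp only [ENNReal.ofReal_lt_iff_lt_toReal (le_of_lt ht) (hf' _)]

/-- The one-dimensional Prékopa–Leindler inequality for functions with supremum one. -/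
theorem prekopa_leindler_of_iSup_eq_one {α β : ℝ} (hα : 0 < α) (hβ : 0 < β) (h1 : α + β = 1)
    {f g h : ℝ → ℝ≥0∞} (hf : Measurable f) (hg : Measurable g) (hh : Measurable h)
    (hf1 : ⨆ x, f x = 1) (hg1 : ⨆ x, g x = 1)
    (H : ∀ x y, f x ^ α * g y ^ β ≤ h (α * x + β * y)) :
    (∫⁻ x, f x) ^ α * (∫⁻ x, g x) ^ β ≤ ∫⁻ x, h x := by
  refine (ennreal_geom_mean_le_arith_mean hα hβ h1 _ _).trans ?_
  have hfle : ∀ x, f x ≤ 1 := fun x => hf1 ▸ le_iSup f x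
  have hgle : ∀ x, g x ≤ 1 := fun x => hg1 ▸ le_iSup g x
  have hmeas : ∀ u : ℝ → ℝ≥0∞, Measurable fun t : ℝ => volume {x | ENNReal.ofReal t < u x} := by
    intro u
    refine Antitone.measurable fun s t hst => measure_mono fun x hx => ?_
    exact (ENNReal.ofReal_le_ofReal hst).trans_lt hx
  calc _ = ∫⁻ t in Ioi (0 : ℝ), (ENNReal.ofReal α * volume {x | ENNReal.ofReal t < f x}
          + ENNReal.ofReal β * volume {x | ENNReal.ofReal t < g x}) := by
        rw [lintegral_add_left ((hmeas f).const_mul _), lintegral_const_mul _ (hmeas f),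
          lintegral_const_mul _ (hmeas g),
          lintegral_eq_lintegral_Ioi_volume_lt_toReal hf
            fun x => ((hfle x).trans_lt ENNReal.one_lt_top).ne,
          lintegral_eq_lintegral_Ioi_volume_lt_toReal hg
            fun x => ((hgle x).trans_lt ENNReal.one_lt_top).ne]
    -- For `t < 1` both level sets are nonempty because both suprema are 1; for `t ≥ 1` both are
    -- empty. So `h` matters only below 1, and truncating it gives the finiteness required by the
    -- layer-cake formula.
    _ ≤ ∫⁻ t in Ioi (0 : ℝ), volume {x | ENNReal.ofReal t < min (h x) 1} := by
        refine setLIntegral_mono (hmeas _) fun t ht => ?_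
        rcases le_or_gt 1 (ENNReal.ofReal t) with ht1 | ht1
        · have e1 : {x | ENNReal.ofReal t < f x} = ∅ := by
            ext x; simpa using (hfle x).trans ht1
          have e2 : {x | ENNReal.ofReal t < g x} = ∅ := by
            ext x; simpa using (hgle x).trans ht1
          simp [e1, e2]
        · refine volume_convex_combination_le (measurableSet_lt measurable_const hf)
            (measurableSet_lt measurable_const hg) ?_ ?_ hα hβ ?_
          · exact lt_iSup_iff.1 (hf1 ▸ ht1)
          · exact lt_iSup_iff.1 (hg1 ▸ ht1)
          · intro x hx y hy
            refine lt_min ((lt_of_lt_of_le ?_ (H x y))) ht1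
            calc ENNReal.ofReal t = ENNReal.ofReal t ^ α * ENNReal.ofReal t ^ β := by
                  rw [← ENNReal.rpow_add_of_nonneg _ _ hα.le hβ.le, h1, ENNReal.rpow_one]
              _ < _ := ENNReal.mul_lt_mul (ENNReal.rpow_lt_rpow hx hα)
                  (ENNReal.rpow_lt_rpow hy hβ)
    _ = ∫⁻ x, min (h x) 1 := by
        rw [lintegral_eq_lintegral_Ioi_volume_lt_toReal (hh.min measurable_const)
            fun x => ((min_le_right _ _).trans_lt ENNReal.one_lt_top).ne]
    _ ≤ ∫⁻ x, h x := lintegral_mono fun x => min_le_left _ _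

/-- By homogeneity: dividing `f` by S and `g` by T divides `h` by S^α T^β. -/
theorem prekopa_leindler_of_iSup_ne_top {α β : ℝ} (hα : 0 < α) (hβ : 0 < β) (h1 : α + β = 1)
    {f g h : ℝ → ℝ≥0∞} (hf : Measurable f) (hg : Measurable g) (hh : Measurable h)
    (hf1 : ⨆ x, f x ≠ ∞) (hg1 : ⨆ x, g x ≠ ∞)
    (H : ∀ x y, f x ^ α * g y ^ β ≤ h (α * x + β * y)) :
    (∫⁻ x, f x) ^ α * (∫⁻ x, g x) ^ β ≤ ∫⁻ x, h x := by
  rcases eq_or_ne (⨆ x, f x) 0 with hf0 | hf0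
  · have : f = 0 := funext fun x => by simpa using ENNReal.iSup_eq_zero.1 hf0 x
    simp [this, ENNReal.zero_rpow_of_pos hα]
  rcases eq_or_ne (⨆ x, g x) 0 with hg0 | hg0
  · have : g = 0 := funext fun x => by simpa using ENNReal.iSup_eq_zero.1 hg0 x
    simp [this, ENNReal.zero_rpow_of_pos hβ]
  set S := ⨆ x, f x
  set T := ⨆ x, g x
  have hS0 : S ^ α ≠ 0 := by simp [ENNReal.rpow_eq_zero_iff, hf0, hf1]
  have hT0 : T ^ β ≠ 0 := by simp [ENNReal.rpow_eq_zero_iff, hg0, hg1]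
  have hS1 : S ^ α ≠ ∞ := ENNReal.rpow_ne_top_of_nonneg hα.le hf1
  have hT1 : T ^ β ≠ ∞ := ENNReal.rpow_ne_top_of_nonneg hβ.le hg1
  have key := prekopa_leindler_of_iSup_eq_one hα hβ h1 (f := fun x => S⁻¹ * f x)
    (g := fun x => T⁻¹ * g x) (h := fun x => ((S ^ α)⁻¹ * (T ^ β)⁻¹) * h x)
    (hf.const_mul _) (hg.const_mul _) (hh.const_mul _)
    (by rw [← ENNReal.mul_iSup]; exact ENNReal.inv_mul_cancel hf0 hf1)
    (by rw [← ENNReal.mul_iSup]; exact ENNReal.inv_mul_cancel hg0 hg1)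
    (fun x y => by
      rw [ENNReal.mul_rpow_of_nonneg _ _ hα.le, ENNReal.mul_rpow_of_nonneg _ _ hβ.le,
        ENNReal.inv_rpow, ENNReal.inv_rpow, mul_mul_mul_comm]
      gcongr
      exact H x y)
  rw [lintegral_const_mul _ hf, lintegral_const_mul _ hg, lintegral_const_mul _ hh,
    ENNReal.mul_rpow_of_nonneg _ _ hα.le, ENNReal.mul_rpow_of_nonneg _ _ hβ.le,
    ENNReal.inv_rpow, ENNReal.inv_rpow, mul_mul_mul_comm] at key
  refine (ENNReal.mul_le_mul_iff_right ?_ ?_).1 key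
  · simp [hS1, hT1]
  · exact ENNReal.mul_ne_top (by simp [hS0]) (by simp [hT0])

theorem lintegral_eq_iSup_lintegral_min_natCast {f : ℝ → ℝ≥0∞} (hf : Measurable f) :
    ∫⁻ x, f x = ⨆ k : ℕ, ∫⁻ x, min (f x) k := by
  rw [← lintegral_iSup (fun k => hf.min measurable_const)
    (fun k l hkl x => min_le_min_left _ (by exact_mod_cast hkl))]
  congr 1
  ext x
  rw [← inf_iSup_eq, ENNReal.iSup_natCast]
  simp

/-- A measure on a real vector space satisfies the Prékopa–Leindler inequality. -/
def SatisfiesPrekopaLeindler {E : Type*} [AddCommGroup E] [Module ℝ E] [MeasurableSpace E]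
    (μ : Measure E) : Prop :=
  ∀ ⦃α β : ℝ⦄, 0 < α → 0 < β → α + β = 1 → ∀ ⦃f g h : E → ℝ≥0∞⦄,
    Measurable f → Measurable g → Measurable h →
    (∀ x y, f x ^ α * g y ^ β ≤ h (α • x + β • y)) →
    (∫⁻ x, f x ∂μ) ^ α * (∫⁻ x, g x ∂μ) ^ β ≤ ∫⁻ x, h x ∂μ

/-- Unbounded functions are truncated at integer heights; monotone convergence passes to the limit,
since positive powers commute with suprema. -/
theorem satisfiesPrekopaLeindler_volume : SatisfiesPrekopaLeindler (volume : Measure ℝ) := by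
  intro α β hα hβ h1 f g h hf hg hh H
  rw [lintegral_eq_iSup_lintegral_min_natCast hf, lintegral_eq_iSup_lintegral_min_natCast hg]
  have e1 := (ENNReal.orderIsoRpow α hα).map_iSup fun k : ℕ => ∫⁻ x, min (f x) k
  have e2 := (ENNReal.orderIsoRpow β hβ).map_iSup fun k : ℕ => ∫⁻ x, min (g x) k
  simp only [ENNReal.orderIsoRpow_apply] at e1 e2
  rw [e1, e2, ENNReal.iSup_mul]
  refine iSup_le fun k => ?_
  rw [ENNReal.mul_iSup]
  refine iSup_le fun l => ?_
  refine prekopa_leindler_of_iSup_ne_top hα hβ h1 (hf.min measurable_const)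
    (hg.min measurable_const) hh ?_ ?_ fun x y => le_trans ?_ (H x y)
  · exact ((iSup_le fun x => min_le_right _ _).trans_lt (ENNReal.natCast_lt_top k)).ne
  · exact ((iSup_le fun x => min_le_right _ _).trans_lt (ENNReal.natCast_lt_top l)).ne
  · gcongr <;> exact min_le_left _ _

theorem SatisfiesPrekopaLeindler.withDensity {E : Type*} [AddCommGroup E] [Module ℝ E]
    [MeasurableSpace E] {μ : Measure E} (hμ : SatisfiesPrekopaLeindler μ) {p : E → ℝ≥0∞}
    (hp : Measurable p)
    (hlog : ∀ ⦃α β : ℝ⦄, 0 < α → 0 < β → α + β = 1 → ∀ x y,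
      p x ^ α * p y ^ β ≤ p (α • x + β • y)) :
    SatisfiesPrekopaLeindler (μ.withDensity p) := by
  intro α β hα hβ h1 f g h hf hg hh H
  rw [lintegral_withDensity_eq_lintegral_mul _ hp hf, lintegral_withDensity_eq_lintegral_mul _ hp hg,
    lintegral_withDensity_eq_lintegral_mul _ hp hh]
  refine hμ hα hβ h1 (hp.mul hf) (hp.mul hg) (hp.mul hh) fun x y => ?_
  simp only [Pi.mul_apply]
  rw [ENNReal.mul_rpow_of_nonneg _ _ hα.le, ENNReal.mul_rpow_of_nonneg _ _ hβ.le,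
    mul_mul_mul_comm]
  exact mul_le_mul' (hlog hα hβ h1 x y) (H x y)

/-- Tensorization: the inequality for ν on slices is the hypothesis needed to apply the inequality
for μ to the partial integrals. -/
theorem SatisfiesPrekopaLeindler.prod {E F : Type*} [AddCommGroup E] [Module ℝ E]
    [MeasurableSpace E] [AddCommGroup F] [Module ℝ F] [MeasurableSpace F]
    {μ : Measure E} {ν : Measure F} [SFinite μ] [SFinite ν]
    (hμ : SatisfiesPrekopaLeindler μ) (hν : SatisfiesPrekopaLeindler ν) :
    SatisfiesPrekopaLeindler (μ.prod ν) := by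
  intro α β hα hβ h1 f g h hf hg hh H
  rw [lintegral_prod _ hf.aemeasurable, lintegral_prod _ hg.aemeasurable,
    lintegral_prod _ hh.aemeasurable]
  refine hμ hα hβ h1 hf.lintegral_prod_right' hg.lintegral_prod_right' hh.lintegral_prod_right'
    fun x y => ?_
  exact hν hα hβ h1 (hf.comp measurable_prodMk_left) (hg.comp measurable_prodMk_left)
    (hh.comp measurable_prodMk_left) fun u v => H (x, u) (y, v)

theorem SatisfiesPrekopaLeindler.map {E F : Type*} [AddCommGroup E] [Module ℝ E]
    [MeasurableSpace E] [AddCommGroup F] [Module ℝ F] [MeasurableSpace F]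
    {μ : Measure E} (hμ : SatisfiesPrekopaLeindler μ) {T : E →ₗ[ℝ] F} (hT : Measurable T) :
    SatisfiesPrekopaLeindler (μ.map T) := by
  intro α β hα hβ h1 f g h hf hg hh H
  rw [lintegral_map hf hT, lintegral_map hg hT, lintegral_map hh hT]
  refine hμ hα hβ h1 (hf.comp hT) (hg.comp hT) (hh.comp hT) fun x y => ?_
  simpa using H (T x) (T y)

theorem SatisfiesPrekopaLeindler.pi {n : ℕ} {μ : Measure ℝ} [SigmaFinite μ]
    (hμ : SatisfiesPrekopaLeindler μ) :
    SatisfiesPrekopaLeindler (Measure.pi fun _ : Fin n => μ) := by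
  induction n with
  | zero =>
    intro α β hα hβ h1 f g h hf hg hh H
    rw [Measure.pi_of_empty _ 0]
    rw [lintegral_dirac' _ hf, lintegral_dirac' _ hg, lintegral_dirac' _ hh]
    simpa using H 0 0
  | succ n ih =>
    have hmp := (measurePreserving_piFinSuccAbove (fun _ : Fin (n + 1) => μ) 0).symm
    rw [← hmp.map_eq]
    let T : (ℝ × (Fin n → ℝ)) →ₗ[ℝ] (Fin (n + 1) → ℝ) :=
      { toFun := (MeasurableEquiv.piFinSuccAbove (fun _ : Fin (n + 1) => ℝ) 0).symm
        map_add' := by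
          intro x y
          ext i
          refine Fin.cases ?_ (fun j => ?_) i <;>
            simp [MeasurableEquiv.piFinSuccAbove]
        map_smul' := by
          intro c x
          ext i
          refine Fin.cases ?_ (fun j => ?_) i <;>
            simp [MeasurableEquiv.piFinSuccAbove] }
    exact (hμ.prod ih).map (T := T)
      (MeasurableEquiv.piFinSuccAbove (fun _ : Fin (n + 1) => ℝ) 0).symm.measurable

/-- Prékopa–Leindler for sets, in the quasi-concave form. -/
theorem SatisfiesPrekopaLeindler.min_measure_le {E : Type*} [AddCommGroup E] [Module ℝ E]
    [MeasurableSpace E] {μ : Measure E} (hμ : SatisfiesPrekopaLeindler μ) {A B C : Set E}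
    (hA : MeasurableSet A) (hB : MeasurableSet B) (hC : MeasurableSet C) {α β : ℝ}
    (hα : 0 < α) (hβ : 0 < β) (h1 : α + β = 1)
    (H : ∀ x ∈ A, ∀ y ∈ B, α • x + β • y ∈ C) : min (μ A) (μ B) ≤ μ C := by
  have key := hμ hα hβ h1 (f := A.indicator 1) (g := B.indicator 1) (h := C.indicator 1)
    (measurable_one.indicator hA) (measurable_one.indicator hB) (measurable_one.indicator hC)
    (fun x y => by
      by_cases hx : x ∈ A
      · by_cases hy : y ∈ B
        · simp [hx, hy, H x hx y hy]
        · simp [hy, hβ]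
      · simp [hx, hα])
  rw [lintegral_indicator_one hA, lintegral_indicator_one hB, lintegral_indicator_one hC] at key
  refine le_trans ?_ key
  calc min (μ A) (μ B) = min (μ A) (μ B) ^ α * min (μ A) (μ B) ^ β := by
        rw [← ENNReal.rpow_add_of_nonneg _ _ hα.le hβ.le, h1, ENNReal.rpow_one]
    _ ≤ _ := by
        gcongr
        · exact min_le_left _ _
        · exact min_le_right _ _

theorem satisfiesPrekopaLeindler_of_hasLogConcaveDensity {Ω : Type*} [MeasurableSpace Ω]
    {μ : Measure Ω} {Y : Ω → ℝ} (h : HasLogConcaveDensity μ Y) :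
    SatisfiesPrekopaLeindler (μ.map Y) := by
  obtain ⟨-, f, hf, hf0, hlog, heq⟩ := h
  rw [heq]
  refine satisfiesPrekopaLeindler_volume.withDensity hf.ennreal_ofReal ?_
  intro α β hα hβ h1 x y
  obtain rfl : β = 1 - α := by linarith
  rw [ENNReal.ofReal_rpow_of_nonneg (hf0 x) hα.le, ENNReal.ofReal_rpow_of_nonneg (hf0 y) hβ.le,
    ← ENNReal.ofReal_mul (Real.rpow_nonneg (hf0 x) _)]
  exact ENNReal.ofReal_le_ofReal (hlog x y α hα.le (by linarith))

end PrekopaLeindler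

/-! ### Weak supmajorization and convex hulls of permutations. -/

section Majorization

/-- Abel summation by induction. The total of `d` may have either sign, so it is kept on the left
with the smallest weight. -/
theorem sum_mul_last_le_sum_mul_of_antitone {n : ℕ} {c d : Fin (n + 1) → ℝ} (hc : Antitone c)
    (hd : ∀ j : Fin (n + 1), (j : ℕ) < n → 0 ≤ ∑ i ∈ Finset.Iic j, d i) :
    c (Fin.last n) * ∑ i, d i ≤ ∑ i, c i * d i := by
  induction n with
  | zero => simp
  | succ n ih =>
    have hprefix : ∀ j : Fin (n + 1), ∑ i ∈ Finset.Iic j, d i.castSucc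
        = ∑ i ∈ Finset.Iic j.castSucc, d i := by
      intro j
      rw [← Fin.map_castSuccEmb_Iic, Finset.sum_map]
      rfl
    have hlast : ∑ i : Fin (n + 1), d i.castSucc = ∑ i ∈ Finset.Iic (Fin.last n).castSucc, d i := by
      rw [← hprefix, ← Fin.top_eq_last, Finset.Iic_top]
    have h := ih (c := fun i => c i.castSucc) (d := fun i => d i.castSucc)
      (fun i j hij => hc (Fin.castSucc_le_castSucc_iff.2 hij))
      (fun j hj => by rw [hprefix]; exact hd _ (by simp; omega))
    have h0 : 0 ≤ ∑ i : Fin (n + 1), d i.castSucc := by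
      rw [hlast]; exact hd _ (by simp)
    rw [Fin.sum_univ_castSucc, Fin.sum_univ_castSucc (f := fun i => c i * d i), mul_add]
    have hle : c (Fin.last (n + 1)) ≤ c (Fin.last n).castSucc := hc (Fin.le_last _)
    nlinarith [mul_le_mul_of_nonneg_right hle h0]

/-- Abel summation: nonnegative decreasing weights preserve domination of partial sums. -/
theorem sum_mul_le_sum_mul_of_antitone {n : ℕ} {c d e : Fin n → ℝ} (hc : Antitone c)
    (hc0 : ∀ i, 0 ≤ c i)
    (hde : ∀ j, ∑ i ∈ Finset.Iic j, d i ≤ ∑ i ∈ Finset.Iic j, e i) :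
    ∑ i, c i * d i ≤ ∑ i, c i * e i := by
  cases n with
  | zero => simp
  | succ n =>
    have hnn : ∀ j : Fin (n + 1), 0 ≤ ∑ i ∈ Finset.Iic j, (e i - d i) := fun j => by
      rw [Finset.sum_sub_distrib]; linarith [hde j]
    have h := sum_mul_last_le_sum_mul_of_antitone hc fun j _ => hnn j
    have h0 := hnn (Fin.last n)
    rw [← Fin.top_eq_last, Finset.Iic_top] at h0
    have := mul_nonneg (hc0 (Fin.last n)) h0
    simp only [mul_sub, Finset.sum_sub_distrib] at h this
    linarith

/-- If `x` is weakly supmajorized by `y`, then for nonnegative weights `w` some rearrangement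
of `y` has a weighted sum at most that of `x`. -/
theorem WeaklySupmajorizedBy.exists_perm_sum_mul_le {n : ℕ} {x y : Fin n → ℝ}
    (h : WeaklySupmajorizedBy x y) {w : Fin n → ℝ} (hw : ∀ i, 0 ≤ w i) :
    ∃ σ : Equiv.Perm (Fin n), ∑ i, w i * y (σ i) ≤ ∑ i, w i * x i := by
  -- Pairing decreasing weights with increasing components minimizes the weighted sum (rearrangement
  -- inequality); Abel summation compares these minimal pairings for `y` and `x`.
  let τ : Equiv.Perm (Fin n) := Tuple.sort (fun i => -w i)
  have hτ : Antitone (w ∘ τ) := fun i j hij => by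
    have := Tuple.monotone_sort (fun i => -w i) hij
    simpa [τ] using this
  have hx : Monotone (increasingArrangement x) := Tuple.monotone_sort x
  refine ⟨τ.symm.trans (Tuple.sort y), ?_⟩
  calc ∑ i, w i * y (τ.symm.trans (Tuple.sort y) i)
      = ∑ i, (w ∘ τ) i * increasingArrangement y i := by
        rw [← Equiv.sum_comp τ]
        simp [increasingArrangement]
    _ ≤ ∑ i, (w ∘ τ) i * increasingArrangement x i :=
        sum_mul_le_sum_mul_of_antitone hτ (fun i => hw _) h
    _ ≤ ∑ i, (w ∘ τ) i * increasingArrangement x ((τ.trans (Tuple.sort x).symm) i) :=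
        (hτ.antivary hx).sum_mul_le_sum_mul_comp_perm
    _ = ∑ i, w i * x i := by
        rw [← Equiv.sum_comp τ (fun i => w i * x i)]
        simp [increasingArrangement]

-- Otherwise Hahn–Banach separates `x` from the closed convex set hull + orthant. The functional is
-- bounded below on a set closed upwards, so its weights are nonnegative, contradicting
-- `exists_perm_sum_mul_le`.
open scoped Pointwise in
theorem WeaklySupmajorizedBy.exists_mem_convexHull_le {n : ℕ} {x y : Fin n → ℝ}
    (h : WeaklySupmajorizedBy x y) :
    ∃ z ∈ convexHull ℝ (range fun σ : Equiv.Perm (Fin n) => y ∘ σ), z ≤ x := by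
  by_contra! hcon
  set K := convexHull ℝ (range fun σ : Equiv.Perm (Fin n) => y ∘ σ)
  have hKc : IsCompact K := (finite_range _).isCompact_convexHull (𝕜 := ℝ)
  have hclosed : IsClosed (K + Ici (0 : Fin n → ℝ)) := isClosed_Ici.add_left_of_isCompact hKc
  have hconv : Convex ℝ (K + Ici (0 : Fin n → ℝ)) := (convex_convexHull ℝ _).add (convex_Ici 0)
  have hx : x ∉ K + Ici (0 : Fin n → ℝ) := by
    rintro ⟨z, hz, p, hp, rfl⟩
    exact hcon z hz (le_add_of_nonneg_right hp)
  obtain ⟨f, u, hfx, hf⟩ := geometric_hahn_banach_point_closed hconv hclosed hx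
  have hyK : ∀ σ : Equiv.Perm (Fin n), y ∘ σ ∈ K := fun σ => subset_convexHull ℝ _ ⟨σ, rfl⟩
  have hsum : ∀ v : Fin n → ℝ, f v = ∑ i, f (Pi.single i 1) * v i := fun v => by
    conv_lhs => rw [pi_eq_sum_univ' v]
    simp [mul_comm]
  have hw : ∀ i, 0 ≤ f (Pi.single i 1) := by
    intro i
    by_contra! hneg
    obtain ⟨s, hs⟩ := exists_nat_gt ((u - f y) / f (Pi.single i 1))
    have h1 := hf (y + (s : ℝ) • Pi.single i 1)
      ⟨y, hyK 1, _, mem_Ici.2 (smul_nonneg (Nat.cast_nonneg s)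
        (Pi.single_nonneg.2 zero_le_one)), rfl⟩
    rw [map_add, map_smul, smul_eq_mul] at h1
    rw [div_lt_iff_of_neg hneg] at hs
    linarith
  obtain ⟨σ, hσ⟩ := h.exists_perm_sum_mul_le hw
  have h1 := hf (y ∘ σ) ⟨y ∘ σ, hyK σ, 0, self_mem_Ici, add_zero _⟩
  rw [hsum] at h1 hfx
  simp only [Function.comp_apply] at h1
  linarith

/-- Convex, permutation invariant upper sets (relative to the nonnegative orthant) are closed
under weak supmajorization. -/
theorem WeaklySupmajorizedBy.mem_of_convex {n : ℕ} {x y : Fin n → ℝ}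
    (h : WeaklySupmajorizedBy x y) {S : Set (Fin n → ℝ)} (hconv : Convex ℝ S)
    (hperm : ∀ v ∈ S, ∀ σ : Equiv.Perm (Fin n), v ∘ σ ∈ S)
    (hup : ∀ v ∈ S, ∀ w, v ≤ w → w ∈ S) (hy : y ∈ S) : x ∈ S := by
  obtain ⟨z, hz, hzx⟩ := h.exists_mem_convexHull_le
  refine hup z (convexHull_min ?_ hconv hz) x hzx
  rintro _ ⟨σ, rfl⟩
  exact hperm y hy σ

theorem MajorizedBy.weaklySupmajorizedBy {n : ℕ} {x y : Fin n → ℝ} (h : MajorizedBy x y) :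
    WeaklySupmajorizedBy x y := by
  intro j
  rcases lt_or_ge ((j : ℕ) + 1) n with hj | hj
  · exact h.2 j hj
  · have : Finset.Iic j = Finset.univ := by
      ext i
      simp only [Finset.mem_Iic, Finset.mem_univ, iff_true, Fin.le_def]
      omega
    rw [this, h.1]

end Majorization

/-! ### Joint concavity of φ(u)ψ(v). -/

section Concavity

open Filter Topology

theorem ContDiffOn.differentiableOn_deriv_of_isOpen {f : ℝ → ℝ} {s : Set ℝ} (hs : IsOpen s)
    (hf : ContDiffOn ℝ 2 f s) : DifferentiableOn ℝ (deriv f) s :=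
  ((contDiffOn_succ_iff_deriv_of_isOpen (n := 1) hs).1 (by exact_mod_cast hf)).2.2.differentiableOn
    (by norm_num)

theorem not_strictAntiOn_of_concaveOn_Ici {φ : ℝ → ℝ} (hφ : ConcaveOn ℝ (Ici 0) φ)
    (hmaps : MapsTo φ (Ici 0) (Ici 0)) : ¬ StrictAntiOn φ (Ici 0) := by
  intro hanti
  have h01 : φ 1 < φ 0 := hanti (by simp) (by simp) one_pos
  set d := φ 0 - φ 1 with hd
  have hd0 : 0 < d := by linarith
  -- At this `s` the line through the graph points over 0 and 1 has height `-d < 0`, and concavity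
  -- keeps `φ s` below it.
  set s := φ 0 / d + 1 with hs
  have hφ0 : 0 ≤ φ 0 := hmaps (by simp)
  have hs1 : 1 ≤ s := by have := div_nonneg hφ0 hd0.le; linarith
  have hφs : 0 ≤ φ s := hmaps (by simp; linarith)
  have hspos : 0 < s := by linarith
  have h := hφ.2 (mem_Ici.2 le_rfl) (mem_Ici.2 hspos.le)
    (sub_nonneg.2 (inv_le_one_of_one_le₀ hs1)) (inv_nonneg.2 hspos.le) (sub_add_cancel 1 s⁻¹)
  simp only [smul_eq_mul, mul_zero, zero_add, inv_mul_cancel₀ hspos.ne'] at h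
  have h2 : s * ((1 - s⁻¹) * φ 0 + s⁻¹ * φ s) ≤ s * φ 1 := by gcongr
  have h3 : s * ((1 - s⁻¹) * φ 0 + s⁻¹ * φ s) = (s - 1) * φ 0 + φ s := by field_simp
  have h4 : s * d = φ 0 + d := by rw [hs]; field_simp
  nlinarith

theorem concaveOn_Ici_of_deriv2_nonpos {φ : ℝ → ℝ} (hcont : ContinuousOn φ (Ici 0))
    (hC2 : ContDiffOn ℝ 2 φ (Ioi 0)) (h2 : ∀ u, 0 < u → deriv (deriv φ) u ≤ 0) :
    ConcaveOn ℝ (Ici 0) φ := by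
  refine concaveOn_of_deriv2_nonpos (convex_Ici 0) hcont ?_ ?_ ?_ <;> rw [interior_Ici]
  · exact hC2.differentiableOn (by norm_num)
  · exact hC2.differentiableOn_deriv_of_isOpen isOpen_Ioi
  · exact fun u hu => h2 u hu

theorem pos_of_strictMonoOn_or_strictAntiOn {φ : ℝ → ℝ} (hmaps : MapsTo φ (Ici 0) (Ici 0))
    (hmono : StrictMonoOn φ (Ici 0) ∨ StrictAntiOn φ (Ici 0)) {u : ℝ} (hu : 0 < u) : 0 < φ u := by
  rcases hmono with h | h
  · exact lt_of_le_of_lt (hmaps (by simp)) (h (by simp) hu.le hu)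
  · have hu1 : u + 1 ∈ Ici (0 : ℝ) := by simp; linarith
    exact lt_of_le_of_lt (hmaps hu1) (h hu.le hu1 (by linarith))

theorem exists_pos_deriv_ne_zero {φ : ℝ → ℝ} (hC2 : ContDiffOn ℝ 2 φ (Ioi 0))
    (hinj : InjOn φ (Ici 0)) : ∃ u, 0 < u ∧ deriv φ u ≠ 0 := by
  by_contra! h
  have h12 : φ 1 = φ 2 := isOpen_Ioi.is_const_of_deriv_eq_zero (s := Ioi (0 : ℝ))
    isPreconnected_Ioi (hC2.differentiableOn (by norm_num)) (fun u hu => h u hu)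
    (by simp) (by simp)
  have := hinj (by simp) (by simp) h12
  norm_num at this

/-- At points where neither first derivative vanishes the product condition forces φ''(u) < 0; with
this `u` fixed, it then determines the sign of ψ'' everywhere. -/
theorem deriv2_nonpos_of_product_condition {φ ψ : ℝ → ℝ}
    (hφ_pos : ∀ u, 0 < u → 0 < φ u) (hψ_pos : ∀ u, 0 < u → 0 < ψ u)
    (hφ_second : ∀ u : ℝ, 0 < u → deriv (deriv φ) u ≤ 0)
    (hφψ : ∀ u v : ℝ, 0 < u → 0 < v →
      (deriv φ u * deriv ψ v) ^ 2 ≤ deriv (deriv φ) u * deriv (deriv ψ) v * φ u * ψ v)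
    (hφ' : ∃ u, 0 < u ∧ deriv φ u ≠ 0) (hψ' : ∃ u, 0 < u ∧ deriv ψ u ≠ 0)
    {v : ℝ} (hv : 0 < v) : deriv (deriv ψ) v ≤ 0 := by
  obtain ⟨u, hu, hu'⟩ := hφ'
  obtain ⟨v₀, hv₀, hv₀'⟩ := hψ'
  have hneg : deriv (deriv φ) u < 0 := by
    refine lt_of_le_of_ne (hφ_second u hu) fun h0 => ?_
    have h := hφψ u v₀ hu hv₀
    have : 0 < (deriv φ u * deriv ψ v₀) ^ 2 := by positivity
    simp only [h0, zero_mul] at h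
    linarith
  by_contra! hpos
  have h1 := (sq_nonneg _).trans (hφψ u v hu hv)
  have h2 : deriv (deriv φ) u * deriv (deriv ψ) v * φ u * ψ v < 0 :=
    mul_neg_of_neg_of_pos (mul_neg_of_neg_of_pos (mul_neg_of_neg_of_pos hneg hpos) (hφ_pos u hu))
      (hψ_pos v hv)
  linarith

/-- A binary quadratic form with nonpositive diagonal and nonnegative determinant is nonpositive. -/
theorem quadratic_form_nonpos {A B C p q : ℝ} (hA : A ≤ 0) (hC : C ≤ 0) (h : B ^ 2 ≤ A * C) :
    A * p ^ 2 + 2 * B * p * q + C * q ^ 2 ≤ 0 := by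
  rcases hA.lt_or_eq with hA | rfl
  · by_contra! hpos
    -- Completing the square, the left side is (Ap + Bq)² + (AC − B²)q².
    have : A * (A * p ^ 2 + 2 * B * p * q + C * q ^ 2) < 0 := mul_neg_of_neg_of_pos hA hpos
    nlinarith [sq_nonneg (A * p + B * q), mul_nonneg (sub_nonneg.2 h) (sq_nonneg q)]
  · have : B = 0 := by nlinarith
    subst this
    nlinarith [sq_nonneg q]

theorem concaveOn_mul_of_product_condition {φ ψ : ℝ → ℝ} (hφ_C2 : ContDiffOn ℝ 2 φ (Ioi 0))
    (hψ_C2 : ContDiffOn ℝ 2 ψ (Ioi 0))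
    (hφ_pos : ∀ u, 0 < u → 0 < φ u) (hψ_pos : ∀ u, 0 < u → 0 < ψ u)
    (hφ_second : ∀ u : ℝ, 0 < u → deriv (deriv φ) u ≤ 0)
    (hψ_second : ∀ u : ℝ, 0 < u → deriv (deriv ψ) u ≤ 0)
    (hφψ : ∀ u v : ℝ, 0 < u → 0 < v →
      (deriv φ u * deriv ψ v) ^ 2 ≤ deriv (deriv φ) u * deriv (deriv ψ) v * φ u * ψ v) :
    ConcaveOn ℝ (Ioi (0 : ℝ) ×ˢ Ioi (0 : ℝ)) fun z => φ z.1 * ψ z.2 := by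
  refine ⟨(convex_Ioi 0).prod (convex_Ioi 0), ?_⟩
  rintro ⟨u₁, v₁⟩ ⟨hu₁, hv₁⟩ ⟨u₂, v₂⟩ ⟨hu₂, hv₂⟩ a b ha hb hab
  simp only [mem_Ioi] at hu₁ hv₁ hu₂ hv₂
  set p := u₂ - u₁
  set q := v₂ - v₁
  -- Concavity is tested along a line. Its full open parameter set in the quadrant is used so that 0
  -- and 1 are interior and ordinary derivatives apply.
  let D : Set ℝ := {s | 0 < u₁ + s * p} ∩ {s | 0 < v₁ + s * q}
  have hDopen : IsOpen D :=
    (isOpen_lt continuous_const (by fun_prop)).inter (isOpen_lt continuous_const (by fun_prop))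
  have hDconv : Convex ℝ D := by
    rintro s ⟨hs1, hs2⟩ t ⟨ht1, ht2⟩ a b ha hb hab
    obtain rfl : a = 1 - b := by linarith
    simp only [mem_ofPred_eq, smul_eq_mul, D, mem_inter_iff] at *
    constructor
    · have : u₁ + ((1 - b) * s + b * t) * p = (1 - b) * (u₁ + s * p) + b * (u₁ + t * p) := by ring
      rw [this]
      rcases hb.eq_or_lt with rfl | hb
      · simpa using hs1
      · have := mul_nonneg ha hs1.le
        positivity
    · have : v₁ + ((1 - b) * s + b * t) * q = (1 - b) * (v₁ + s * q) + b * (v₁ + t * q) := by ring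
      rw [this]
      rcases hb.eq_or_lt with rfl | hb
      · simpa using hs2
      · have := mul_nonneg ha hs2.le
        positivity
  have hd1 : ∀ {f : ℝ → ℝ}, ContDiffOn ℝ 2 f (Ioi 0) → ∀ {u}, 0 < u →
      HasDerivAt f (deriv f u) u := fun hf u hu =>
    ((hf.differentiableOn (by norm_num)).differentiableAt (isOpen_Ioi.mem_nhds hu)).hasDerivAt
  have hd2 : ∀ {f : ℝ → ℝ}, ContDiffOn ℝ 2 f (Ioi 0) → ∀ {u}, 0 < u →
      HasDerivAt (deriv f) (deriv (deriv f) u) u := fun hf u hu =>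
    ((hf.differentiableOn_deriv_of_isOpen isOpen_Ioi).differentiableAt
      (isOpen_Ioi.mem_nhds hu)).hasDerivAt
  have hl1 : ∀ s, HasDerivAt (fun s => u₁ + s * p) p s := fun s => by
    simpa using ((hasDerivAt_id s).mul_const p).const_add u₁
  have hl2 : ∀ s, HasDerivAt (fun s => v₁ + s * q) q s := fun s => by
    simpa using ((hasDerivAt_id s).mul_const q).const_add v₁
  let F : ℝ → ℝ := fun s => φ (u₁ + s * p) * ψ (v₁ + s * q)
  let F' : ℝ → ℝ := fun s => deriv φ (u₁ + s * p) * p * ψ (v₁ + s * q)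
    + φ (u₁ + s * p) * (deriv ψ (v₁ + s * q) * q)
  let F'' : ℝ → ℝ := fun s => (deriv (deriv φ) (u₁ + s * p) * p * p * ψ (v₁ + s * q)
      + deriv φ (u₁ + s * p) * p * (deriv ψ (v₁ + s * q) * q))
    + (deriv φ (u₁ + s * p) * p * (deriv ψ (v₁ + s * q) * q)
      + φ (u₁ + s * p) * (deriv (deriv ψ) (v₁ + s * q) * q * q))
  have hF : ∀ s ∈ D, HasDerivAt F (F' s) s := fun s hs =>
    ((hd1 hφ_C2 hs.1).comp s (hl1 s)).mul ((hd1 hψ_C2 hs.2).comp s (hl2 s))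
  have hF' : ∀ s ∈ D, HasDerivAt F' (F'' s) s := fun s hs => by
    have e1 : HasDerivAt (fun s => φ (u₁ + s * p)) (deriv φ (u₁ + s * p) * p) s :=
      (hd1 hφ_C2 hs.1).comp s (hl1 s)
    have e2 : HasDerivAt (fun s => ψ (v₁ + s * q)) (deriv ψ (v₁ + s * q) * q) s :=
      (hd1 hψ_C2 hs.2).comp s (hl2 s)
    have e3 : HasDerivAt (fun s => deriv φ (u₁ + s * p) * p)
        (deriv (deriv φ) (u₁ + s * p) * p * p) s :=
      (HasDerivAt.comp (h₂ := deriv φ) s (hd2 hφ_C2 hs.1) (hl1 s)).mul_const p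
    have e4 : HasDerivAt (fun s => deriv ψ (v₁ + s * q) * q)
        (deriv (deriv ψ) (v₁ + s * q) * q * q) s :=
      (HasDerivAt.comp (h₂ := deriv ψ) s (hd2 hψ_C2 hs.2) (hl2 s)).mul_const q
    exact (e3.mul e2).add (e1.mul e4)
  have hderiv : EqOn (deriv F) F' D := fun s hs => (hF s hs).deriv
  have hderiv2 : ∀ s ∈ D, HasDerivAt (deriv F) (F'' s) s := fun s hs =>
    (hF' s hs).congr_of_eventuallyEq (hderiv.eventuallyEq_of_mem (hDopen.mem_nhds hs))
  have hconc : ConcaveOn ℝ D F := by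
    refine concaveOn_of_deriv2_nonpos' hDconv
      (fun s hs => (hF s hs).differentiableAt.differentiableWithinAt)
      (fun s hs => (hderiv2 s hs).differentiableAt.differentiableWithinAt) fun s hs => ?_
    have hq := quadratic_form_nonpos (p := p) (q := q)
      (A := deriv (deriv φ) (u₁ + s * p) * ψ (v₁ + s * q))
      (B := deriv φ (u₁ + s * p) * deriv ψ (v₁ + s * q))
      (C := φ (u₁ + s * p) * deriv (deriv ψ) (v₁ + s * q))
      (mul_nonpos_of_nonpos_of_nonneg (hφ_second _ hs.1) (hψ_pos _ hs.2).le)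
      (mul_nonpos_of_nonneg_of_nonpos (hφ_pos _ hs.1).le (hψ_second _ hs.2))
      ((hφψ _ _ hs.1 hs.2).trans (by apply le_of_eq; ring))
    have : deriv^[2] F s = F'' s := (hderiv2 s hs).deriv
    rw [this]
    simp only [F'']
    linarith
  have h0 : (0 : ℝ) ∈ D := by simp [D, hu₁, hv₁]
  have h1 : (1 : ℝ) ∈ D := by simp [D, p, q, hu₂, hv₂]
  have h := hconc.2 h0 h1 ha hb hab
  obtain rfl : a = 1 - b := by linarith
  simp only [F, smul_eq_mul, mul_zero, zero_add, mul_one, zero_mul, add_zero, one_mul, p, q,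
    add_sub_cancel] at h
  simp only [Prod.smul_mk, Prod.mk_add_mk, smul_eq_mul]
  convert h using 3 <;> ring

/-- Shift every point by (ε, ε) into the open quadrant and let ε ↓ 0. -/
theorem ConcaveOn.mul_Ici_prod_Ici {φ ψ : ℝ → ℝ} (hφ : ContinuousOn φ (Ici 0))
    (hψ : ContinuousOn ψ (Ici 0))
    (h : ConcaveOn ℝ (Ioi (0 : ℝ) ×ˢ Ioi (0 : ℝ)) fun z => φ z.1 * ψ z.2) :
    ConcaveOn ℝ (Ici (0 : ℝ) ×ˢ Ici (0 : ℝ)) fun z => φ z.1 * ψ z.2 := by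
  refine ⟨(convex_Ici 0).prod (convex_Ici 0), ?_⟩
  rintro ⟨u₁, v₁⟩ ⟨hu₁, hv₁⟩ ⟨u₂, v₂⟩ ⟨hu₂, hv₂⟩ a b ha hb hab
  simp only [mem_Ici] at hu₁ hv₁ hu₂ hv₂
  simp only [Prod.smul_mk, Prod.mk_add_mk, smul_eq_mul]
  have hlim : ∀ {f : ℝ → ℝ}, ContinuousOn f (Ici 0) → ∀ {u}, 0 ≤ u →
      Tendsto (fun ε => f (u + ε)) (𝓝[>] 0) (𝓝 (f u)) := by
    intro f hf u hu
    refine (hf u hu).tendsto.comp (tendsto_nhdsWithin_iff.2 ⟨?_, ?_⟩)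
    · refine Tendsto.mono_left ?_ nhdsWithin_le_nhds
      have : Continuous fun ε : ℝ => u + ε := by fun_prop
      simpa using this.tendsto 0
    · filter_upwards [self_mem_nhdsWithin] with ε (hε : 0 < ε)
      exact (by positivity : 0 ≤ u + ε)
  refine le_of_tendsto_of_tendsto
    ((((hlim hφ hu₁).mul (hlim hψ hv₁)).const_mul a).add
      (((hlim hφ hu₂).mul (hlim hψ hv₂)).const_mul b))
    ((hlim hφ (by positivity : 0 ≤ a * u₁ + b * u₂)).mul
      (hlim hψ (by positivity : 0 ≤ a * v₁ + b * v₂))) ?_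
  filter_upwards [self_mem_nhdsWithin] with ε (hε : 0 < ε)
  have hmem : ∀ u v : ℝ, 0 ≤ u → 0 ≤ v → (u + ε, v + ε) ∈ Ioi (0 : ℝ) ×ˢ Ioi (0 : ℝ) :=
    fun u v hu hv => ⟨mem_Ioi.2 (by positivity), mem_Ioi.2 (by positivity)⟩
  have := h.2 (hmem u₁ v₁ hu₁ hv₁) (hmem u₂ v₂ hu₂ hv₂) ha hb hab
  simp only [Prod.smul_mk, Prod.mk_add_mk, smul_eq_mul] at this
  obtain rfl : a = 1 - b := by linarith
  convert this using 3 <;> ring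

end Concavity

/-! ### Superlevel sets and tails of weighted sums. -/

section WeightedSums

open scoped ENNReal

/-- The part of the nonnegative orthant on which `∑ φ(xᵢ) ψ(vᵢ)` exceeds `t`; the function `ψ`
is evaluated at positive parts so that only its values on `[0, ∞)` matter. -/
def superlevelSet {n : ℕ} (φ ψ : ℝ → ℝ) (t : ℝ) (x : Fin n → ℝ) : Set (Fin n → ℝ) :=
  {v | (∀ i, 0 ≤ v i) ∧ t < ∑ i, φ (x i) * ψ (max (v i) 0)}

theorem continuous_comp_max_zero {ψ : ℝ → ℝ} (hψ : ContinuousOn ψ (Ici 0)) :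
    Continuous fun v => ψ (max v 0) :=
  hψ.comp_continuous (by fun_prop) fun v => le_max_right v 0

theorem measurableSet_superlevelSet {n : ℕ} {φ ψ : ℝ → ℝ} (hψ : ContinuousOn ψ (Ici 0)) (t : ℝ)
    (x : Fin n → ℝ) : MeasurableSet (superlevelSet φ ψ t x) := by
  have hψ' := (continuous_comp_max_zero hψ).measurable
  refine MeasurableSet.inter (s₁ := {v : Fin n → ℝ | ∀ i, 0 ≤ v i}) ?_ ?_
  · simp only [ofPred_forall]
    exact MeasurableSet.iInter fun i => measurableSet_le measurable_const (measurable_pi_apply i)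
  · exact measurableSet_lt measurable_const (Finset.measurable_sum _ fun i _ =>
      (hψ'.comp (measurable_pi_apply i)).const_mul _)

theorem superlevelSet_mono {n : ℕ} {φ ψ : ℝ → ℝ} (hφ : MonotoneOn φ (Ici 0))
    (hψ : MapsTo ψ (Ici 0) (Ici 0)) (t : ℝ) {x y : Fin n → ℝ} (hx : ∀ i, 0 ≤ x i) (hxy : x ≤ y) :
    superlevelSet φ ψ t x ⊆ superlevelSet φ ψ t y := by
  rintro v ⟨hv, ht⟩
  refine ⟨hv, ht.trans_le (Finset.sum_le_sum fun i _ => mul_le_mul_of_nonneg_right ?_ ?_)⟩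
  · exact hφ (hx i) ((hx i).trans (hxy i)) (hxy i)
  · exact hψ (mem_Ici.2 (le_max_right _ _))

/-- Joint concavity is essential here, as the parameters and the points are averaged simultaneously.
-/
theorem convex_combination_mem_superlevelSet {n : ℕ} {φ ψ : ℝ → ℝ}
    (h : ConcaveOn ℝ (Ici (0 : ℝ) ×ˢ Ici (0 : ℝ)) fun z => φ z.1 * ψ z.2) {t : ℝ}
    {x y v w : Fin n → ℝ} (hx : ∀ i, 0 ≤ x i) (hy : ∀ i, 0 ≤ y i) (hv : v ∈ superlevelSet φ ψ t x)
    (hw : w ∈ superlevelSet φ ψ t y) {α β : ℝ} (hα : 0 < α) (hβ : 0 < β) (h1 : α + β = 1) :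
    α • v + β • w ∈ superlevelSet φ ψ t (α • x + β • y) := by
  obtain ⟨hv0, hv⟩ := hv
  obtain ⟨hw0, hw⟩ := hw
  have hnn : ∀ i, 0 ≤ (α • v + β • w) i := fun i =>
    add_nonneg (mul_nonneg hα.le (hv0 i)) (mul_nonneg hβ.le (hw0 i))
  refine ⟨hnn, ?_⟩
  simp only [max_eq_left (hnn _)]
  simp only [max_eq_left (hv0 _)] at hv
  simp only [max_eq_left (hw0 _)] at hw
  calc t = α * t + β * t := by rw [← add_mul, h1, one_mul]
    _ < α * ∑ i, φ (x i) * ψ (v i) + β * ∑ i, φ (y i) * ψ (w i) := by gcongr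
    _ = ∑ i, (α * (φ (x i) * ψ (v i)) + β * (φ (y i) * ψ (w i))) := by
        rw [Finset.sum_add_distrib, Finset.mul_sum, Finset.mul_sum]
    _ ≤ _ := Finset.sum_le_sum fun i _ =>
        h.2 (mk_mem_prod (hx i) (hv0 i)) (mk_mem_prod (hy i) (hw0 i)) hα.le hβ.le h1

theorem measure_superlevelSet_comp_perm {n : ℕ} {φ ψ : ℝ → ℝ} (hψ : ContinuousOn ψ (Ici 0)) (t : ℝ)
    (ν : Measure ℝ) [SigmaFinite ν] (x : Fin n → ℝ) (σ : Equiv.Perm (Fin n)) :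
    Measure.pi (fun _ : Fin n => ν) (superlevelSet φ ψ t (x ∘ σ)) =
      Measure.pi (fun _ : Fin n => ν) (superlevelSet φ ψ t x) := by
  have hmp := measurePreserving_piCongrLeft (fun _ : Fin n => ν) σ.symm
  rw [← hmp.measure_preimage (measurableSet_superlevelSet hψ t _).nullMeasurableSet]
  congr 1
  have hcoe : ∀ v : Fin n → ℝ,
      MeasurableEquiv.piCongrLeft (fun _ : Fin n => ℝ) σ.symm v = v ∘ σ := fun v => by
    ext i
    have := MeasurableEquiv.piCongrLeft_apply_apply (β := fun _ : Fin n => ℝ) σ.symm v (σ i)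
    simpa using this
  ext v
  simp only [superlevelSet, mem_preimage, mem_ofPred_eq, hcoe, Function.comp_apply]
  rw [Equiv.sum_comp σ fun i => φ (x i) * ψ (max (v i) 0), σ.forall_congr_left]
  simp

/-- If `φ(u) ψ(v)` is jointly concave, the measure of the superlevel sets is monotone with respect
to weak supmajorization. -/
theorem WeaklySupmajorizedBy.measure_superlevelSet_le {n : ℕ} {φ ψ : ℝ → ℝ}
    (hφ : MonotoneOn φ (Ici 0)) (hψ : MapsTo ψ (Ici 0) (Ici 0)) (hψ_cont : ContinuousOn ψ (Ici 0))
    (hconc : ConcaveOn ℝ (Ici (0 : ℝ) ×ˢ Ici (0 : ℝ)) fun z => φ z.1 * ψ z.2) (t : ℝ)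
    {ν : Measure ℝ} [SigmaFinite ν] (hν : SatisfiesPrekopaLeindler ν) {x y : Fin n → ℝ}
    (hy : ∀ i, 0 ≤ y i) (h : WeaklySupmajorizedBy x y) :
    Measure.pi (fun _ : Fin n => ν) (superlevelSet φ ψ t y) ≤
      Measure.pi (fun _ : Fin n => ν) (superlevelSet φ ψ t x) := by
  set P := Measure.pi (fun _ : Fin n => ν)
  refine (h.mem_of_convex (S := {z | (∀ i, 0 ≤ z i) ∧
    P (superlevelSet φ ψ t y) ≤ P (superlevelSet φ ψ t z)}) ?_ ?_ ?_ ⟨hy, le_rfl⟩).2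
  · refine convex_iff_forall_pos.2 ?_
    rintro z ⟨hz, hz'⟩ w ⟨hw, hw'⟩ α β hα hβ h1
    refine ⟨fun i => add_nonneg (mul_nonneg hα.le (hz i)) (mul_nonneg hβ.le (hw i)), ?_⟩
    refine (le_min hz' hw').trans (hν.pi.min_measure_le (measurableSet_superlevelSet hψ_cont t z)
      (measurableSet_superlevelSet hψ_cont t w) (measurableSet_superlevelSet hψ_cont t _) hα hβ h1
      fun u hu v hv => convex_combination_mem_superlevelSet hconc hz hw hu hv hα hβ h1)
  · rintro z ⟨hz, hz'⟩ σ
    exact ⟨fun i => hz _, hz'.trans (measure_superlevelSet_comp_perm hψ_cont t ν z σ).ge⟩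
  · rintro z ⟨hz, hz'⟩ w hzw
    exact ⟨fun i => (hz i).trans (hzw i), hz'.trans (measure_mono (superlevelSet_mono hφ hψ t hz hzw))⟩

theorem inverseOnNonneg_nonneg {g : ℝ → ℝ} {x : ℝ} (hx : x ∈ g '' Ici 0) :
    0 ≤ inverseOnNonneg g x :=
  Function.invFunOn_mem hx

theorem apply_inverseOnNonneg {g : ℝ → ℝ} {x : ℝ} (hx : x ∈ g '' Ici 0) :
    g (inverseOnNonneg g x) = x :=
  Function.invFunOn_eq hx

variable {Ω : Type*} [MeasurableSpace Ω] {μ : Measure Ω} [IsProbabilityMeasure μ]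

/-- The tail of a weighted sum of i.i.d. variables `ψ(Vᵢ)` in terms of the law of `V`. -/
theorem measure_lt_sum_mul_eq {n : ℕ} {X : Fin n → Ω → ℝ} (hX_meas : ∀ i, Measurable (X i))
    (hX_indep : iIndepFun X μ) {φ ψ : ℝ → ℝ} (hψ : ContinuousOn ψ (Ici 0)) {V : Ω → ℝ}
    (hV : AEMeasurable V μ) (hV0 : ∀ᵐ ω ∂μ, 0 ≤ V ω)
    (hX_law : ∀ i, μ.map (X i) = μ.map fun ω => ψ (V ω)) (t : ℝ) (x : Fin n → ℝ) :
    μ {ω | t < ∑ i, φ (x i) * X i ω} =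
      Measure.pi (fun _ : Fin n => μ.map V) (superlevelSet φ ψ t x) := by
  have hprob : IsProbabilityMeasure (μ.map V) := Measure.isProbabilityMeasure_map hV
  have hψ' := (continuous_comp_max_zero hψ).measurable
  have hlaw : ∀ i, μ.map (X i) = (μ.map V).map fun v => ψ (max v 0) := fun i => by
    rw [hX_law i, AEMeasurable.map_map_of_aemeasurable hψ'.aemeasurable hV]
    refine Measure.map_congr ?_
    filter_upwards [hV0] with ω hω
    simp [max_eq_left hω]
  have hmap : IsProbabilityMeasure ((μ.map V).map fun v => ψ (max v 0)) :=
    Measure.isProbabilityMeasure_map hψ'.aemeasurable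
  have hjoint : μ.map (fun ω i => X i ω) =
      (Measure.pi fun _ : Fin n => μ.map V).map fun v i => ψ (max (v i) 0) := by
    rw [hX_indep.map_fun_eq_pi_map fun i => (hX_meas i).aemeasurable,
      Measure.pi_map_pi fun _ => hψ'.aemeasurable]
    simp only [hlaw]
  have hmeas : Measurable fun (v : Fin n → ℝ) i => ψ (max (v i) 0) :=
    measurable_pi_lambda _ fun i => hψ'.comp (measurable_pi_apply i)
  have hset : MeasurableSet {w : Fin n → ℝ | t < ∑ i, φ (x i) * w i} :=
    measurableSet_lt measurable_const (by fun_prop)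
  have h1 := Measure.map_apply (μ := μ) (measurable_pi_lambda _ hX_meas) hset
  rw [hjoint, Measure.map_apply hmeas hset] at h1
  refine h1.symm.trans (measure_congr ?_)
  have hnn : ∀ᵐ v ∂(Measure.pi fun _ : Fin n => μ.map V), ∀ i, 0 ≤ v i := by
    refine ae_all_iff.2 fun i => Measure.tendsto_eval_ae_ae.eventually ?_
    exact (ae_map_iff hV measurableSet_Ici).2 hV0
  filter_upwards [hnn] with v hv
  exact propext ⟨fun h => ⟨hv, h⟩, fun h => h.2⟩

theorem stochasticLE_of_forall_measure_lt_le {X Y : Ω → ℝ} (hX : Measurable X) (hY : Measurable Y)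
    (h : ∀ t, μ {ω | t < X ω} ≤ μ {ω | t < Y ω}) : StochasticLE μ X Y := by
  intro t
  have hcompl : ∀ {Z : Ω → ℝ}, Measurable Z → μ {ω | Z ω ≤ t} = 1 - μ {ω | t < Z ω} := by
    intro Z hZ
    rw [← prob_compl_eq_one_sub (measurableSet_lt measurable_const hZ)]
    congr 1
    ext ω
    simp
  rw [hcompl hX, hcompl hY]
  exact tsub_le_tsub_left (h t) 1

end WeightedSums

/-! ### The stochastic comparison. -/

theorem theorem3p2 {Ω : Type*} [MeasurableSpace Ω] (μ : Measure Ω) [IsProbabilityMeasure μ]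
    (n : ℕ) (X : Fin n → Ω → ℝ)
    (hX_meas : ∀ i, Measurable (X i))
    (hX_indep : iIndepFun X μ)
    (hX_ident : ∀ i j, IdentDistrib (X i) (X j) μ μ)
    (hX_ac : ∀ i, μ.map (X i) ≪ (volume : Measure ℝ))
    (hX_nonneg : ∀ i, ∀ᵐ ω ∂μ, 0 ≤ X i ω)
    (φ ψ : ℝ → ℝ)
    (hφ_maps : MapsTo φ (Ici 0) (Ici 0))
    (hψ_maps : MapsTo ψ (Ici 0) (Ici 0))
    (hφ_cont : ContinuousOn φ (Ici 0))
    (hψ_cont : ContinuousOn ψ (Ici 0))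
    (hφ_C2 : ContDiffOn ℝ 2 φ (Ioi 0))
    (hψ_C2 : ContDiffOn ℝ 2 ψ (Ioi 0))
    (hφ_mono : StrictMonoOn φ (Ici 0) ∨ StrictAntiOn φ (Ici 0))
    (hψ_mono : StrictMonoOn ψ (Ici 0) ∨ StrictAntiOn ψ (Ici 0))
    (hφ_second : ∀ u : ℝ, 0 < u → deriv (deriv φ) u ≤ 0)
    (hφψ : ∀ u v : ℝ, 0 < u → 0 < v →
      (deriv φ u * deriv ψ v) ^ 2 ≤ deriv (deriv φ) u * deriv (deriv ψ) v * φ u * ψ v)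
    (hX_range : ∀ i, ∀ᵐ ω ∂μ, X i ω ∈ ψ '' Ici 0)
    (hX_density : ∀ i, HasLogConcaveDensity μ (fun ω => inverseOnNonneg ψ (X i ω)))
    (a b : Fin n → ℝ)
    (ha : ∀ i, a i ∈ φ '' Ici 0)
    (hb : ∀ i, b i ∈ φ '' Ici 0) :
    (MajorizedBy (fun i => inverseOnNonneg φ (b i)) (fun i => inverseOnNonneg φ (a i)) →
      StochasticLE μ (fun ω => ∑ i, a i * X i ω) (fun ω => ∑ i, b i * X i ω)) ∧
    (StrictMonoOn φ (Ici 0) →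
      WeaklySupmajorizedBy (fun i => inverseOnNonneg φ (b i)) (fun i => inverseOnNonneg φ (a i)) →
      StochasticLE μ (fun ω => ∑ i, a i * X i ω) (fun ω => ∑ i, b i * X i ω)) ∧
    (StrictAntiOn φ (Ici 0) →
      WeaklySubmajorizedBy (fun i => inverseOnNonneg φ (b i)) (fun i => inverseOnNonneg φ (a i)) →
      StochasticLE μ (fun ω => ∑ i, a i * X i ω) (fun ω => ∑ i, b i * X i ω)) := by
  have hφ_conc := concaveOn_Ici_of_deriv2_nonpos hφ_cont hφ_C2 hφ_second
  have hφ_incr : StrictMonoOn φ (Ici 0) :=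
    hφ_mono.resolve_right (not_strictAntiOn_of_concaveOn_Ici hφ_conc hφ_maps)
  have hφ_pos : ∀ u, 0 < u → 0 < φ u := fun u hu =>
    pos_of_strictMonoOn_or_strictAntiOn hφ_maps hφ_mono hu
  have hψ_pos : ∀ u, 0 < u → 0 < ψ u := fun u hu =>
    pos_of_strictMonoOn_or_strictAntiOn hψ_maps hψ_mono hu
  have hψ_inj : InjOn ψ (Ici 0) := hψ_mono.elim StrictMonoOn.injOn StrictAntiOn.injOn
  have hψ_second : ∀ v, 0 < v → deriv (deriv ψ) v ≤ 0 := fun v hv =>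
    deriv2_nonpos_of_product_condition hφ_pos hψ_pos hφ_second hφψ
      (exists_pos_deriv_ne_zero hφ_C2 hφ_incr.injOn) (exists_pos_deriv_ne_zero hψ_C2 hψ_inj) hv
  have hconc : ConcaveOn ℝ (Ici (0 : ℝ) ×ˢ Ici (0 : ℝ)) fun z => φ z.1 * ψ z.2 :=
    ConcaveOn.mul_Ici_prod_Ici hφ_cont hψ_cont
      (concaveOn_mul_of_product_condition hφ_C2 hψ_C2 hφ_pos hψ_pos hφ_second hψ_second hφψ)
  have main : WeaklySupmajorizedBy (fun i => inverseOnNonneg φ (b i))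
      (fun i => inverseOnNonneg φ (a i)) →
      StochasticLE μ (fun ω => ∑ i, a i * X i ω) (fun ω => ∑ i, b i * X i ω) := by
    intro h
    -- An index is needed to name the common law of the variables; for `n = 0` both sums vanish.
    rcases isEmpty_or_nonempty (Fin n) with hn | ⟨⟨i₀⟩⟩
    · intro t
      simp
    refine stochasticLE_of_forall_measure_lt_le (by fun_prop) (by fun_prop) fun t => ?_
    have hV := (hX_density i₀).1
    have hprob : IsProbabilityMeasure (μ.map fun ω => inverseOnNonneg ψ (X i₀ ω)) :=
      Measure.isProbabilityMeasure_map hV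
    have hV0 : ∀ᵐ ω ∂μ, 0 ≤ inverseOnNonneg ψ (X i₀ ω) :=
      (hX_range i₀).mono fun ω hω => inverseOnNonneg_nonneg hω
    have hlaw : ∀ i, μ.map (X i) = μ.map fun ω => ψ (inverseOnNonneg ψ (X i₀ ω)) := fun i => by
      rw [(hX_ident i i₀).map_eq]
      exact Measure.map_congr ((hX_range i₀).mono fun ω hω => (apply_inverseOnNonneg hω).symm)
    have htail := measure_lt_sum_mul_eq (φ := φ) hX_meas hX_indep hψ_cont hV hV0 hlaw t
    have ha' := htail fun i => inverseOnNonneg φ (a i)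
    have hb' := htail fun i => inverseOnNonneg φ (b i)
    simp only [apply_inverseOnNonneg (ha _)] at ha'
    simp only [apply_inverseOnNonneg (hb _)] at hb'
    rw [ha', hb']
    exact h.measure_superlevelSet_le hφ_incr.monotoneOn hψ_maps hψ_cont hconc t
      (satisfiesPrekopaLeindler_of_hasLogConcaveDensity (hX_density i₀))
      fun i => inverseOnNonneg_nonneg (ha i)
  exact ⟨fun h => main h.weaklySupmajorizedBy, fun _ h => main h,
    fun h => absurd h (not_strictAntiOn_of_concaveOn_Ici hφ_conc hφ_maps)⟩
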